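/- **Setting.** Let $n\ge 2$. For $1\le L\le K\le n$ let $z:\{1,\dots,n\}\to\{1,\dots,K\}$ and $c:\{1,\dots,K\}\to\{1,\dots,L\}$ be clustering functions, with clustering matrices $Z$ and $C$: they assign nodes to $K$ communities and communities to $L$ meta-communities. Let $\mathscr P_{Z,C}$ be the permutation matrix that arranges the nodes so that the meta-communities, and within each of them the communities, are consecutive; for an $n\times n$ matrix $M$ put $M(Z,C)=\mathscr P_{Z,C}^T M\mathscr P_{Z,C}$. Let $J^{(l)}$ be the $0/1$ membership matrix of the nodes of meta-community $l$ in its communities. The set $\Im(n,K,L)$ (for the given $Z,C$) consists of the matrices $\Theta\in[0,1]^{n\times n}$, in the rearranged order, for which there are $B\in[0,1]^{K\times K}$ and $H\in\mathbb R_+^{n\times L}$ such that, for all $l_1,l_2$, the $(l_1,l_2)$ meta-block of $\Theta$ is $$\Theta^{(l_1,l_2)}=Q^{(l_1,l_2)}J^{(l_1)}B^{(l_1,l_2)}(J^{(l_2)})^TQ^{(l_2,l_1)},\qquad (J^{(l_1)})^TQ^{(l_1,l_2)}J^{(l_1)}=(J^{(l_1)})^TJ^{(l_1)},$$ where $B^{(l_1,l_2)}$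 is the block of $B$ with rows the communities of $l_1$ and columns those of $l_2$, and $Q^{(l_1,l_2)}$ is the diagonal matrix whose diagonal is the part of column $l_2$ of $H$ on the nodes of meta-community $l_1$. A matrix $P=\mathscr P_{Z,C}\Theta\mathscr P_{Z,C}^T$ with $\Theta\in\Im(n,K,L)$ is called an NBM (Nested Block Model) matrix. Let $P_*=\mathscr P_{Z_*,C_*}\Theta_*\mathscr P_{Z_*,C_*}^T$ be a symmetric NBM matrix, with parameters $K_*,L_*,Z_*,C_*,B_*,H_*$, such that * **A1.** $B_*$ is non-singular, with smallest singular value at least some $\lambda_0>0$; * **A2.** for each community $k$, the $L_*$ sub-vectors $h^{(k,l)}$, $l=1,\dots,L_*$, of the columns of $H_*$ on the nodes of community $k$ are linearly independent. Let $A\in\{0,1\}^{n\times n}$ be a random symmetric matrix with zero diagonal whose entries $A_{ij}$, $i<j$, are independent Bernoulli$((P_*)_{ij})$. Put $\mathrm{Pen}(K,L)=C_1(nL+K^2)\ln n+C_2\,n\ln K$, let $(\widehat\Theta,\widehat Z,\widehat C,\widehat K,\widehat L)$ be a solution of $$\min_{Z,C,K,L,\Theta}\ \|A(Z,C)-\Theta\|_F^2+\mathrm{Pen}(K,L),\qquad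 1\le L\le K\le n,\ \Theta\in\Im(n,K,L)\text{ for }Z,C,$$ and put $\widehat P=\mathscr P_{\widehat Z,\widehat C}\,\widehat\Theta\,\mathscr P_{\widehat Z,\widehat C}^T$. **Theorem.** There are absolute constants $c_1,c_2>0$ such that, whenever $C_1\ge c_1$ and $C_2\ge c_2$, the following holds in the above setting, for all $1\le L\le K\le n$, all $Z$, $C$ and every matrix $P=\mathscr P_{Z,C}\Theta\mathscr P_{Z,C}^T$ with $\Theta\in\Im(n,K,L)$: $$\mathbb P\Big\{\|\widehat P-P_*\|_F^2\le 3\big[\|P-P_*\|_F^2+\mathrm{Pen}(K,L)\big]\Big\}\ \ge\ 1-(n^2\log_2 n+1)e^{-n/32},$$ $$\mathbb E\|\widehat P-P_*\|_F^2\ \le\ 3\big[\|P-P_*\|_F^2+\mathrm{Pen}(K,L)\big]+n^5e^{-n/32}.$$ -/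

import Mathlib

open MeasureTheory ProbabilityTheory
open scoped Matrix

namespace NBM

noncomputable section

/-- Squared Frobenius norm of a real square matrix. -/
def frobSq {n : ℕ} (M : Matrix (Fin n) (Fin n) ℝ) : ℝ := ∑ i, ∑ j, M i j ^ 2

/-- The penalty `C₁ (n L + K²) ln n + C₂ n ln K`. -/
def pen (C₁ C₂ : ℝ) (n K L : ℕ) : ℝ :=
  C₁ * ((n : ℝ) * L + (K : ℝ) ^ 2) * Real.log n + C₂ * n * Real.log K

/-! Throughout, a clustering matrix `Z ∈ 𝓜_{n,K}` (resp. `C ∈ 𝓜_{K,L}`) is given by its clustering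
function `z : Fin n → Fin K` (resp. `c : Fin K → Fin L`). -/

section Arrangement

variable {n K L : ℕ} (z : Fin n → Fin K) (c : Fin K → Fin L)

/-- The rearrangement of the nodes that puts meta-communities consecutively and, within each of
them, communities consecutively: `arrange z c a` is the node that occupies position `a`. -/
def arrange : Equiv.Perm (Fin n) :=
  Tuple.sort (fun i : Fin n => toLex (c (z i), z i))

/-- The permutation matrix `𝒫_{Z,C}`: its column `a` is the unit vector of the node at
position `a`. -/
def permMat : Matrix (Fin n) (Fin n) ℝ := (arrange z c)⁻¹.permMatrix ℝ

/-- `M(Z,C) = 𝒫ᵀ M 𝒫`. -/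
def rearranged (M : Matrix (Fin n) (Fin n) ℝ) : Matrix (Fin n) (Fin n) ℝ :=
  (permMat z c)ᵀ * M * permMat z c

/-- `𝒫 Θ 𝒫ᵀ`: the matrix in the original order of the nodes. -/
def restored (Θ : Matrix (Fin n) (Fin n) ℝ) : Matrix (Fin n) (Fin n) ℝ :=
  permMat z c * Θ * (permMat z c)ᵀ

/-- The community of the node at position `a`. -/
def comm (a : Fin n) : Fin K := z (arrange z c a)

/-- The meta-community of the node at position `a`. -/
def metaComm (a : Fin n) : Fin L := c (comm z c a)

/-- The positions that belong to meta-community `l`. -/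
abbrev MetaPos (l : Fin L) : Type := {a : Fin n // metaComm z c a = l}

/-- The communities that form meta-community `l`. -/
abbrev MetaBlocks (l : Fin L) : Type := {k : Fin K // c k = l}

/-- The `N_l × K_l` membership matrix `J^{(l)}`. -/
def J (l : Fin L) : Matrix (MetaPos z c l) (MetaBlocks c l) ℝ :=
  Matrix.of fun a k => if comm z c a.1 = k.1 then 1 else 0

/-- `Q^{(l,l')} = diag (H^{(l,l')})`, where `H^{(l,l')}` is the part of column `l'` of `H` on the
positions of meta-community `l`. The rows of `H` are in the rearranged order. -/
def Q (H : Matrix (Fin n) (Fin L) ℝ) (l l' : Fin L) :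
    Matrix (MetaPos z c l) (MetaPos z c l) ℝ :=
  Matrix.diagonal fun a => H a.1 l'

/-- The matrix `Θ` (in the rearranged order) follows the Nested Block Model with clusterings
`z`, `c`, block matrix `B` and heterogeneity matrix `H`. -/
structure IsNBMRep (B : Matrix (Fin K) (Fin K) ℝ) (H : Matrix (Fin n) (Fin L) ℝ)
    (Θ : Matrix (Fin n) (Fin n) ℝ) : Prop where
  theta_mem : ∀ a b, Θ a b ∈ Set.Icc (0 : ℝ) 1
  B_mem : ∀ k k', B k k' ∈ Set.Icc (0 : ℝ) 1
  H_nonneg : ∀ a l, 0 ≤ H a l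
  scaling : ∀ l l', (J z c l)ᵀ * Q z c H l l' * J z c l = (J z c l)ᵀ * J z c l
  block : ∀ l₁ l₂ : Fin L,
    Θ.submatrix (fun a : MetaPos z c l₁ => a.1) (fun b : MetaPos z c l₂ => b.1) =
      Q z c H l₁ l₂ * J z c l₁ *
        B.submatrix (fun k : MetaBlocks c l₁ => k.1) (fun k : MetaBlocks c l₂ => k.1) *
        (J z c l₂)ᵀ * Q z c H l₂ l₁

/-- The set `ℑ(n,K,L)` of admissible `Θ`, for the clusterings `z`, `c`. -/
def paramSet : Set (Matrix (Fin n) (Fin n) ℝ) := {Θ | ∃ B H, IsNBMRep z c B H Θ}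

/-- For each community `k`, the sub-vectors `h^{(k,l)}`, `l = 1, …, L`, of the columns of `H` are
linearly independent. -/
def SubvectorsIndep (H : Matrix (Fin n) (Fin L) ℝ) : Prop :=
  ∀ k : Fin K, LinearIndependent ℝ
    (fun l : Fin L => fun a : {a : Fin n // comm z c a = k} => H a.1 l)

end Arrangement

/-- `B` is non-singular, with all singular values at least `lam`. -/
def WellConditioned {K : ℕ} (B : Matrix (Fin K) (Fin K) ℝ) (lam : ℝ) : Prop :=
  IsUnit B.det ∧ ∀ k : Fin K, lam ≤ (Matrix.toEuclideanLin B).singularValues k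

/-- An admissible point `(Θ, Z, C, K, L)` of the optimization problem. -/
structure Candidate (n : ℕ) where
  K : ℕ
  L : ℕ
  one_le_L : 1 ≤ L
  L_le_K : L ≤ K
  K_le_n : K ≤ n
  z : Fin n → Fin K
  c : Fin K → Fin L
  Θ : Matrix (Fin n) (Fin n) ℝ
  mem : Θ ∈ paramSet z c

/-- The estimated probability matrix `P̂ = 𝒫 Θ̂ 𝒫ᵀ`. -/
def Candidate.prob {n : ℕ} (f : Candidate n) : Matrix (Fin n) (Fin n) ℝ :=
  restored f.z f.c f.Θ

/-- The penalized criterion `‖A(Z,C) - Θ‖_F² + Pen(K,L)`. -/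
def criterion {n : ℕ} (C₁ C₂ : ℝ) (A : Matrix (Fin n) (Fin n) ℝ) (f : Candidate n) : ℝ :=
  frobSq (rearranged f.z f.c A - f.Θ) + pen C₁ C₂ n f.K f.L

/-- `f` solves the penalized least squares problem for the adjacency matrix `A`. -/
def IsSolution {n : ℕ} (C₁ C₂ : ℝ) (A : Matrix (Fin n) (Fin n) ℝ) (f : Candidate n) : Prop :=
  ∀ g : Candidate n, criterion C₁ C₂ A f ≤ criterion C₁ C₂ A g

/-- `A` is the random adjacency matrix of an undirected network without self-loops, whose edges
are independent with connection probabilities `P`. -/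
structure IsNetwork {Ω : Type*} [MeasurableSpace Ω] (μ : Measure Ω) {n : ℕ}
    (P : Matrix (Fin n) (Fin n) ℝ) (A : Ω → Matrix (Fin n) (Fin n) ℝ) : Prop where
  measurable : ∀ i j, Measurable fun ω => A ω i j
  zero_or_one : ∀ ω i j, A ω i j = 0 ∨ A ω i j = 1
  symm : ∀ ω, (A ω).IsSymm
  no_loops : ∀ ω i, A ω i i = 0
  edge_prob : ∀ i j, i < j → μ.real {ω | A ω i j = 1} = P i j
  indep : iIndepFun (fun (e : {e : Fin n × Fin n // e.1 < e.2}) ω => A ω e.1.1 e.1.2) μ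

end

end NBM

/-!
A matrix in `ℑ(n, K, L)`, put back into the original order of the nodes, has the entries
`H i (c (z j)) * B (z i) (z j) * H j (c (z i))`. The scaling condition bounds the nonnegative
numbers `H i l` by the size of a community, hence by `n`. Rounding `H` and `B` down to multiples of `n⁻⁴`
therefore moves each entry by at most `1 / n`, and the rounded matrices form a finite net whose
cardinality has logarithm of order `(n L + K²) ln n + n ln K`, the order of the penalty
(`exists_netPoint_near`, `card_netIndex_le`).

For a fixed direction `D`, Hoeffding's lemma bounds the inner product of the centred noise with `D`
by `‖D‖² / 16 + 4 s` up to probability `exp (-s)` (`IsNetwork.deviation`). A union bound over the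
nets of all pairs `(K, L)`, with `s` the entropy of the net plus `2 ln n + n`, and one more
application to the direction of the competitor, leave an exceptional event of probability at most
`2 exp (-n)`. Outside of it, comparing the criterion at the estimator and at the competitor gives
`(3 / 4) ‖P̂ - P_*‖² ≤ (9 / 8) ‖P - P_*‖² + Pen(K, L) + 13 n`: the penalty of the estimator
absorbs the noise on its net, and terms of order `n`, among them the bias on the diagonal, where `A`
vanishes, are absorbed by the penalty of the competitor (`oracle_of_noise_le`). The bound in
expectation follows since `‖P̂ - P_*‖² ≤ n²` always.
-/

namespace NBM

open Finset

variable {n K L : ℕ}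

/-! ### Entries of the Nested Block Model matrices -/

lemma rearranged_apply (z : Fin n → Fin K) (c : Fin K → Fin L) (M : Matrix (Fin n) (Fin n) ℝ)
    (a b : Fin n) :
    rearranged z c M a b = M (arrange z c a) (arrange z c b) := by
  simp only [rearranged, permMat, Matrix.transpose_permMatrix, inv_inv,
    PEquiv.toMatrix_toPEquiv_mul, PEquiv.mul_toMatrix_toPEquiv, Matrix.submatrix_apply, id]
  rfl

lemma restored_apply (z : Fin n → Fin K) (c : Fin K → Fin L) (M : Matrix (Fin n) (Fin n) ℝ)
    (i j : Fin n) :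
    restored z c M i j = M ((arrange z c).symm i) ((arrange z c).symm j) := by
  simp only [restored, permMat, Matrix.transpose_permMatrix, inv_inv,
    PEquiv.toMatrix_toPEquiv_mul, PEquiv.mul_toMatrix_toPEquiv, Matrix.submatrix_apply, id]
  rfl

lemma frobSq_rearranged_sub (z : Fin n → Fin K) (c : Fin K → Fin L)
    (A Θ : Matrix (Fin n) (Fin n) ℝ) :
    frobSq (rearranged z c A - Θ) = frobSq (A - restored z c Θ) := by
  simp only [frobSq, Matrix.sub_apply, rearranged_apply, restored_apply]
  refine Fintype.sum_equiv (arrange z c) _ _ fun a => ?_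
  exact Fintype.sum_equiv (arrange z c) _ _ fun b => by simp

lemma frobSq_nonneg (M : Matrix (Fin n) (Fin n) ℝ) : 0 ≤ frobSq M :=
  sum_nonneg fun _ _ => sum_nonneg fun _ _ => sq_nonneg _

lemma restored_mem_Icc {z : Fin n → Fin K} {c : Fin K → Fin L} {Θ : Matrix (Fin n) (Fin n) ℝ}
    (h : Θ ∈ paramSet z c) (i j : Fin n) : restored z c Θ i j ∈ Set.Icc (0 : ℝ) 1 := by
  obtain ⟨B, H, hr⟩ := h
  rw [restored_apply]
  exact hr.theta_mem _ _

lemma Candidate.prob_mem_Icc (f : Candidate n) (i j : Fin n) :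
    f.prob i j ∈ Set.Icc (0 : ℝ) 1 := restored_mem_Icc f.mem i j

lemma IsNBMRep.apply {z : Fin n → Fin K} {c : Fin K → Fin L} {B : Matrix (Fin K) (Fin K) ℝ}
    {H : Matrix (Fin n) (Fin L) ℝ} {Θ : Matrix (Fin n) (Fin n) ℝ} (h : IsNBMRep z c B H Θ)
    (a b : Fin n) :
    Θ a b = H a (metaComm z c b) * B (comm z c a) (comm z c b) * H b (metaComm z c a) := by
  have h1 := congr_fun (congr_fun (h.block (metaComm z c a) (metaComm z c b)) ⟨a, rfl⟩) ⟨b, rfl⟩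
  simp only [Matrix.submatrix_apply] at h1
  rw [h1, Q, Q, Matrix.mul_diagonal]
  congr 1
  have hQ : ∀ k, (Matrix.diagonal (fun x : MetaPos z c (metaComm z c a) => H x.1 (metaComm z c b)) *
      J z c (metaComm z c a)) ⟨a, rfl⟩ k =
      if k = ⟨comm z c a, rfl⟩ then H a (metaComm z c b) else 0 := fun k => by
    rw [Matrix.diagonal_mul, J, Matrix.of_apply]
    simp only [Subtype.ext_iff, eq_comm (b := k.1), mul_ite, mul_one, mul_zero]
  have hJ : ∀ k, (J z c (metaComm z c b))ᵀ k ⟨b, rfl⟩ =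
      if k = ⟨comm z c b, rfl⟩ then 1 else 0 := fun k => by
    rw [Matrix.transpose_apply, J, Matrix.of_apply]
    simp only [Subtype.ext_iff, eq_comm (b := k.1)]
  have hQB : ∀ k, (Matrix.diagonal (fun x : MetaPos z c (metaComm z c a) => H x.1 (metaComm z c b)) *
      J z c (metaComm z c a) * B.submatrix (fun k : MetaBlocks c (metaComm z c a) => k.1)
        (fun k : MetaBlocks c (metaComm z c b) => k.1)) ⟨a, rfl⟩ k =
      H a (metaComm z c b) * B (comm z c a) k.1 := fun k => by
    rw [Matrix.mul_apply, sum_congr rfl fun x _ => by rw [hQ]]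
    simp
  rw [Matrix.mul_apply, sum_congr rfl fun x _ => by rw [hQB, hJ]]
  simp

/-- The scaling condition makes the entries of a column of `H` over a community sum up to the size
of the community, so none of these nonnegative numbers exceeds `n`. -/
lemma IsNBMRep.H_le {z : Fin n → Fin K} {c : Fin K → Fin L} {B : Matrix (Fin K) (Fin K) ℝ}
    {H : Matrix (Fin n) (Fin L) ℝ} {Θ : Matrix (Fin n) (Fin n) ℝ} (h : IsNBMRep z c B H Θ)
    (a : Fin n) (l : Fin L) : H a l ≤ n := by
  have h1 := congr_fun (congr_fun (h.scaling (metaComm z c a) l) ⟨comm z c a, rfl⟩)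
    ⟨comm z c a, rfl⟩
  rw [Matrix.mul_assoc, Matrix.mul_apply, Matrix.mul_apply] at h1
  simp only [Q, Matrix.diagonal_mul, J, Matrix.of_apply, Matrix.transpose_apply] at h1
  calc H a l ≤ ∑ b : MetaPos z c (metaComm z c a), (if comm z c b.1 = comm z c a then (1 : ℝ) else 0)
        * (H b.1 l * if comm z c b.1 = comm z c a then (1 : ℝ) else 0) := by
        refine le_of_eq_of_le ?_ (single_le_sum
          (f := fun b : MetaPos z c (metaComm z c a) =>
            (if comm z c b.1 = comm z c a then (1 : ℝ) else 0)
              * (H b.1 l * if comm z c b.1 = comm z c a then (1 : ℝ) else 0))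
          (fun b _ => ?_) (mem_univ ⟨a, rfl⟩))
        · simp
        · have := h.H_nonneg b.1 l
          positivity
    _ = _ := h1
    _ ≤ ∑ b : MetaPos z c (metaComm z c a), (1 : ℝ) := by
        refine sum_le_sum fun b _ => ?_
        split_ifs <;> norm_num
    _ ≤ n := by
        simp only [sum_const, card_univ, nsmul_eq_mul, mul_one, Nat.cast_le]
        exact (Fintype.card_subtype_le _).trans_eq (Fintype.card_fin n)

lemma exists_restored_eq {z : Fin n → Fin K} {c : Fin K → Fin L} {Θ : Matrix (Fin n) (Fin n) ℝ}
    (h : Θ ∈ paramSet z c) :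
    ∃ (B : Fin K → Fin K → ℝ) (H : Fin n → Fin L → ℝ), (∀ k k', B k k' ∈ Set.Icc (0 : ℝ) 1) ∧
      (∀ i l, H i l ∈ Set.Icc (0 : ℝ) n) ∧
      ∀ i j, restored z c Θ i j = H i (c (z j)) * B (z i) (z j) * H j (c (z i)) := by
  obtain ⟨B, H, hr⟩ := h
  refine ⟨B, fun i l => H ((arrange z c).symm i) l, hr.B_mem,
    fun i l => ⟨hr.H_nonneg _ _, hr.H_le _ _⟩, fun i j => ?_⟩
  rw [restored_apply, hr.apply]
  simp [metaComm, comm]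

/-! ### A finite net -/

/-- Indices of a finite net of the Nested Block Model matrices with `K` communities and `L`
meta-communities: the two clusterings together with the entries of `H` and `B`, rounded down to
multiples of `1 / n ^ 4` and stored as numerators. -/
abbrev NetIndex (n K L : ℕ) : Type :=
  (Fin n → Fin K) × (Fin K → Fin L) × (Fin n → Fin L → Fin (n ^ 5 + 1)) ×
    (Fin K → Fin K → Fin (n ^ 4 + 1))

/-- The point of the net with a given index, in the original order of the nodes. It need not be an
NBM matrix, since rounding destroys the scaling condition. -/
noncomputable def netPoint (p : NetIndex n K L) : Matrix (Fin n) (Fin n) ℝ :=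
  Matrix.of fun i j =>
    ((p.2.2.1 i (p.2.1 (p.1 j)) : ℕ) : ℝ) / (n : ℝ) ^ 4 *
      (((p.2.2.2 (p.1 i) (p.1 j) : ℕ) : ℝ) / (n : ℝ) ^ 4) *
      (((p.2.2.1 j (p.2.1 (p.1 i)) : ℕ) : ℝ) / (n : ℝ) ^ 4)

lemma exists_fin_div_approx {m N : ℕ} (hm : 0 < m) {x : ℝ} (hx : 0 ≤ x) (hxN : x * m ≤ N) :
    ∃ k : Fin (N + 1), ((k : ℕ) : ℝ) / m ≤ x ∧ x ≤ ((k : ℕ) : ℝ) / m + 1 / m := by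
  have hm' : (0 : ℝ) < m := by exact_mod_cast hm
  refine ⟨⟨⌊x * m⌋₊, Nat.lt_succ_of_le (Nat.floor_le_of_le hxN)⟩, ?_, ?_⟩
  · rw [div_le_iff₀ hm']
    exact Nat.floor_le (by positivity)
  · rw [← add_div, le_div_iff₀ hm']
    exact (Nat.lt_floor_add_one _).le

lemma abs_mul_mul_sub_le {x x' y y' b b' R e : ℝ} (hx : x ≤ R) (hy0 : 0 ≤ y) (hy : y ≤ R)
    (hb0 : 0 ≤ b) (hb : b ≤ 1) (hx0' : 0 ≤ x') (hb0' : 0 ≤ b')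
    (hx' : x' ≤ x) (hy' : y' ≤ y) (hb' : b' ≤ b)
    (ex : x ≤ x' + e) (ey : y ≤ y' + e) (eb : b ≤ b' + e) :
    |x * b * y - x' * b' * y'| ≤ (2 * R + R ^ 2) * e := by
  have he : 0 ≤ e := by linarith
  have hR : 0 ≤ R := by linarith
  have e1 : (x - x') * (b * y) ≤ e * (1 * R) := by gcongr; linarith
  have e2 : x' * ((b - b') * y) ≤ R * (e * R) := by gcongr <;> linarith
  have e3 : x' * (b' * (y - y')) ≤ R * (1 * e) := by gcongr <;> linarith
  have p1 : 0 ≤ (x - x') * (b * y) := mul_nonneg (by linarith) (by positivity)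
  have p2 : 0 ≤ x' * ((b - b') * y) := mul_nonneg hx0' (mul_nonneg (by linarith) hy0)
  have p3 : 0 ≤ x' * (b' * (y - y')) := mul_nonneg hx0' (mul_nonneg hb0' (by linarith))
  rw [abs_of_nonneg (by linarith)]
  linarith

/-- The net approximates every NBM matrix to within `1 / n` in each entry. -/
lemma exists_netPoint_near (hn : 2 ≤ n) {z : Fin n → Fin K} {c : Fin K → Fin L}
    {Θ : Matrix (Fin n) (Fin n) ℝ} (h : Θ ∈ paramSet z c) :
    ∃ p : NetIndex n K L, ∀ i j, |restored z c Θ i j - netPoint p i j| ≤ 1 / n := by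
  obtain ⟨B, H, hB, hH, hr⟩ := exists_restored_eq h
  have hn' : (2 : ℝ) ≤ n := by exact_mod_cast hn
  have hm : 0 < n ^ 4 := by positivity
  choose h' h1 h2 using fun i l => exists_fin_div_approx (N := n ^ 5) hm (hH i l).1 (by
    push_cast
    calc H i l * (n : ℝ) ^ 4 ≤ n * (n : ℝ) ^ 4 := by gcongr; exact (hH i l).2
      _ = _ := by ring)
  choose b' b1 b2 using fun k k' => exists_fin_div_approx (N := n ^ 4) hm (hB k k').1 (by
    push_cast
    exact mul_le_of_le_one_left (by positivity) (hB k k').2)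
  push_cast at h1 h2 b1 b2
  refine ⟨(z, c, h', b'), fun i j => ?_⟩
  rw [hr, netPoint, Matrix.of_apply]
  refine (abs_mul_mul_sub_le (hH _ _).2 (hH _ _).1 (hH _ _).2 (hB _ _).1 (hB _ _).2
    (by positivity) (by positivity) (h1 _ _) (h1 _ _) (b1 _ _)
    (h2 _ _) (h2 _ _) (b2 _ _)).trans ?_
  rw [mul_one_div, div_le_div_iff₀ (by positivity) (by positivity)]
  have : 0 ≤ (n : ℝ) ^ 2 * (((n : ℝ) - 2) * (n + 1)) := by
    have : (0 : ℝ) ≤ n - 2 := by linarith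
    positivity
  nlinarith

/-- The constant `6` in the entropy bound comes from `n ^ 5 + 1 ≤ n ^ 6`. -/
lemma card_netIndex_le (hn : 2 ≤ n) (hL : 1 ≤ L) (hLK : L ≤ K) (hK : K ≤ n) :
    (Fintype.card (NetIndex n K L) : ℝ) ≤
      Real.exp (6 * ((n : ℝ) * L + (K : ℝ) ^ 2) * Real.log n + n * Real.log K) := by
  have hn' : (2 : ℝ) ≤ n := by exact_mod_cast hn
  have hn0 : (0 : ℝ) < n := by linarith
  have hK0 : (0 : ℝ) < K := by exact_mod_cast (by omega : 0 < K)
  have hexp : ∀ m : ℕ, Real.exp (m * Real.log n) = (n : ℝ) ^ m := fun m => by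
    rw [Real.exp_nat_mul, Real.exp_log hn0]
  have hsucc : ∀ m : ℕ, 1 ≤ m → (n : ℝ) ^ m + 1 ≤ (n : ℝ) ^ (m + 1) := fun m hm => by
    have : (1 : ℝ) ≤ (n : ℝ) ^ m := one_le_pow₀ (by linarith)
    rw [pow_succ]; nlinarith
  have e1 : 6 * ((n : ℝ) * L + (K : ℝ) ^ 2) * Real.log n + n * Real.log K
      = n * Real.log K + ((K ^ 2 : ℕ) * Real.log n + ((6 * (L * n) : ℕ) * Real.log n
        + (5 * (K * K) : ℕ) * Real.log n)) := by
    push_cast; ring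
  rw [e1, Real.exp_add, Real.exp_add, Real.exp_add, hexp, hexp, hexp, Real.exp_nat_mul,
    Real.exp_log hK0]
  simp only [Fintype.card_prod, Fintype.card_fun, Fintype.card_fin]
  push_cast
  have hLn : (L : ℝ) ^ K ≤ (n : ℝ) ^ K ^ 2 :=
    (pow_le_pow_left₀ (by positivity) (by exact_mod_cast hLK.trans hK) K).trans
      (pow_le_pow_right₀ (by linarith) (by nlinarith))
  have hH : (((n : ℝ) ^ 5 + 1) ^ L) ^ n ≤ (n : ℝ) ^ (6 * (L * n)) := by
    rw [← pow_mul, pow_mul (n : ℝ) 6]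
    exact pow_le_pow_left₀ (by positivity) (hsucc 5 (by norm_num)) _
  have hB : (((n : ℝ) ^ 4 + 1) ^ K) ^ K ≤ (n : ℝ) ^ (5 * (K * K)) := by
    rw [← pow_mul, pow_mul (n : ℝ) 5]
    exact pow_le_pow_left₀ (by positivity) (hsucc 4 (by norm_num)) _
  gcongr

/-! ### Deviations of the noise -/

/-- The Frobenius inner product. -/
def frobInner (M N : Matrix (Fin n) (Fin n) ℝ) : ℝ := ∑ i, ∑ j, M i j * N i j

/-- The centred adjacency matrix, with the diagonal removed: the diagonal of `A` is zero while that
of `P` need not be, so `A - P` is not centred there. -/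
def noise (A P : Matrix (Fin n) (Fin n) ℝ) : Matrix (Fin n) (Fin n) ℝ :=
  Matrix.of fun i j => if i = j then 0 else A i j - P i j

lemma sum_sum_eq_sum_lt (f : Fin n → Fin n → ℝ) :
    ∑ i, ∑ j, f i j = ∑ i, f i i + ∑ e : {e : Fin n × Fin n // e.1 < e.2},
      (f e.1.1 e.1.2 + f e.1.2 e.1.1) := by
  have h1 : ∀ g : Fin n → Fin n → ℝ, ∑ e : {e : Fin n × Fin n // e.1 < e.2}, g e.1.1 e.1.2
      = ∑ i, ∑ j, if i < j then g i j else 0 := fun g => by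
    rw [← Fintype.sum_prod_type' (f := fun i j => if i < j then g i j else 0), ← sum_filter]
    exact (sum_subtype (univ.filter fun e : Fin n × Fin n => e.1 < e.2) (fun e => by simp)
      fun e => g e.1 e.2).symm
  rw [sum_add_distrib, h1 f, h1 fun i j => f j i,
    sum_comm (f := fun i j => if i < j then f j i else 0), ← sum_add_distrib, ← sum_add_distrib]
  refine sum_congr rfl fun i _ => ?_
  have : f i i = ∑ j, if i = j then f i j else 0 := by simp
  rw [this, ← sum_add_distrib, ← sum_add_distrib]
  refine sum_congr rfl fun j _ => ?_
  rcases lt_trichotomy i j with h | h | h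
  · simp [h, h.ne, h.not_gt]
  · simp [h]
  · simp [h, h.ne', h.not_gt]

section Probability

variable {Ω : Type*} [MeasurableSpace Ω] {μ : Measure Ω}
  {A : Ω → Matrix (Fin n) (Fin n) ℝ} {P : Matrix (Fin n) (Fin n) ℝ}

lemma IsNetwork.integral_edge (hA : IsNetwork μ P A) {i j : Fin n} (hij : i < j) :
    ∫ ω, A ω i j ∂μ = P i j := by
  have hs : MeasurableSet {ω | A ω i j = 1} := hA.measurable i j (measurableSet_singleton 1)
  have : (fun ω => A ω i j) = {ω | A ω i j = 1}.indicator fun _ => (1 : ℝ) := by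
    ext ω
    rcases hA.zero_or_one ω i j with h | h <;> simp [Set.indicator, h]
  rw [this, integral_indicator_const _ hs, hA.edge_prob i j hij]
  simp

lemma IsNetwork.frobInner_noise (hA : IsNetwork μ P A) (hP : P.IsSymm)
    (D : Matrix (Fin n) (Fin n) ℝ) (ω : Ω) :
    frobInner (noise (A ω) P) D = ∑ e : {e : Fin n × Fin n // e.1 < e.2},
      (D e.1.1 e.1.2 + D e.1.2 e.1.1) * (A ω e.1.1 e.1.2 - P e.1.1 e.1.2) := by
  rw [frobInner, sum_sum_eq_sum_lt]
  simp only [noise, Matrix.of_apply, if_true, zero_mul, sum_const_zero, zero_add]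
  refine sum_congr rfl fun e _ => ?_
  rw [if_neg e.2.ne, if_neg e.2.ne', (hA.symm ω).apply e.1.1 e.1.2, hP.apply e.1.1 e.1.2]
  ring

variable [IsProbabilityMeasure μ]

lemma IsNetwork.hasSubgaussianMGF_edge (hA : IsNetwork μ P A) {i j : Fin n} (hij : i < j) :
    HasSubgaussianMGF (fun ω => A ω i j - P i j) (1 / 4) μ := by
  have h := hasSubgaussianMGF_of_mem_Icc (μ := μ) (a := 0) (b := 1)
    (hA.measurable i j).aemeasurable (ae_of_all _ fun ω => by
      rcases hA.zero_or_one ω i j with h | h <;> simp [h])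
  rw [hA.integral_edge hij] at h
  convert h using 1
  norm_num

lemma sum_lt_add_sq_le (D : Matrix (Fin n) (Fin n) ℝ) :
    ∑ e : {e : Fin n × Fin n // e.1 < e.2}, (D e.1.1 e.1.2 + D e.1.2 e.1.1) ^ 2 ≤ 2 * frobSq D := by
  rw [frobSq, sum_sum_eq_sum_lt, mul_add,
    mul_sum (s := univ (α := {e : Fin n × Fin n // e.1 < e.2}))]
  refine le_add_of_nonneg_of_le (by positivity) (sum_le_sum fun e _ => ?_)
  nlinarith [sq_nonneg (D e.1.1 e.1.2 - D e.1.2 e.1.1)]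

/-- Hoeffding's bound in self-normalized form. The Chernoff parameter is kept at `1 / 4`, instead of
being optimized, to make the threshold affine in `‖D‖²`. -/
lemma IsNetwork.deviation (hA : IsNetwork μ P A) (hP : P.IsSymm) (D : Matrix (Fin n) (Fin n) ℝ)
    (s : ℝ) :
    μ.real {ω | frobSq D / 8 + 8 * s ≤ 2 * frobInner (noise (A ω) P) D} ≤ Real.exp (-s) := by
  have hind := hA.indep.comp (fun e x => (D e.1.1 e.1.2 + D e.1.2 e.1.1) * (x - P e.1.1 e.1.2))
    fun e => by fun_prop
  have h := HasSubgaussianMGF.sum_of_iIndepFun hind (s := univ)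
    fun e _ => (hA.hasSubgaussianMGF_edge e.2).const_mul (D e.1.1 e.1.2 + D e.1.2 e.1.1)
  simp only [Function.comp_apply, ← hA.frobInner_noise hP] at h
  set X : Ω → ℝ := fun ω => frobInner (noise (A ω) P) D with hX
  have hset : {ω | frobSq D / 8 + 8 * s ≤ 2 * X ω} = {ω | frobSq D / 16 + 4 * s ≤ X ω} := by
    ext ω
    simp only [Set.mem_ofPred_eq]
    constructor <;> intro h <;> linarith
  refine (measureReal_mono hset.le).trans ?_
  refine (measure_ge_le_exp_mul_mgf _ (by norm_num : (0 : ℝ) ≤ 1 / 4)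
    (h.integrable_exp_mul _)).trans ?_
  refine (mul_le_mul_of_nonneg_left (h.mgf_le _) (Real.exp_pos _).le).trans ?_
  rw [← Real.exp_add, Real.exp_le_exp]
  have h2 := sum_lt_add_sq_le D
  rw [NNReal.coe_sum]
  change -(1 / 4) * (frobSq D / 16 + 4 * s) + (∑ e : {e : Fin n × Fin n // e.1 < e.2},
    (D e.1.1 e.1.2 + D e.1.2 e.1.1) ^ 2 * ((1 / 4 : NNReal) : ℝ)) * (1 / 4) ^ 2 / 2 ≤ -s
  rw [← sum_mul]
  push_cast
  linarith

/-! ### The oracle inequality -/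

/-- The exponent at which the noise is controlled on the net with `K` communities and `L`
meta-communities: the entropy of the net, `2 ln n` for the choice of `K` and `L`, and `n`. -/
noncomputable def netLevel (n K L : ℕ) : ℝ :=
  6 * ((n : ℝ) * L + (K : ℝ) ^ 2) * Real.log n + n * Real.log K + 2 * Real.log n + n

/-- The event that the noise is too large in some direction `M - P`, `M` in the net with `K`
communities and `L` meta-communities. -/
def netBad (A : Ω → Matrix (Fin n) (Fin n) ℝ) (P : Matrix (Fin n) (Fin n) ℝ) (K L : ℕ) : Set Ω :=
  ⋃ p : NetIndex n K L, {ω | frobSq (netPoint p - P) / 8 + 8 * netLevel n K L ≤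
    2 * frobInner (noise (A ω) P) (netPoint p - P)}

lemma IsNetwork.measure_netBad_le (hA : IsNetwork μ P A) (hP : P.IsSymm) (hn : 2 ≤ n)
    (hL : 1 ≤ L) (hLK : L ≤ K) (hK : K ≤ n) :
    μ.real (netBad A P K L) ≤ Real.exp (-n) / (n : ℝ) ^ 2 := by
  have hn0 : (0 : ℝ) < n := by exact_mod_cast (by omega : 0 < n)
  calc μ.real (netBad A P K L)
      ≤ ∑ p : NetIndex n K L, Real.exp (-netLevel n K L) :=
        (measureReal_iUnion_fintype_le _).trans (sum_le_sum fun p _ => hA.deviation hP _ _)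
    _ = Fintype.card (NetIndex n K L) * Real.exp (-netLevel n K L) := by
        rw [sum_const, card_univ, nsmul_eq_mul]
    _ ≤ Real.exp (6 * ((n : ℝ) * L + (K : ℝ) ^ 2) * Real.log n + n * Real.log K)
          * Real.exp (-netLevel n K L) := by
        gcongr
        exact card_netIndex_le hn hL hLK hK
    _ = Real.exp (-n - Real.log ((n : ℝ) ^ 2)) := by
        rw [← Real.exp_add, Real.log_pow, netLevel]
        congr 1
        push_cast
        ring
    _ = Real.exp (-n) / (n : ℝ) ^ 2 := by
        rw [Real.exp_sub, Real.exp_log (by positivity)]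

lemma IsNetwork.measure_biUnion_netBad_le (hA : IsNetwork μ P A) (hP : P.IsSymm) (hn : 2 ≤ n) :
    μ.real (⋃ q ∈ (Icc 1 n ×ˢ Icc 1 n).filter (fun q : ℕ × ℕ => q.2 ≤ q.1), netBad A P q.1 q.2)
      ≤ Real.exp (-n) := by
  have hn0 : (0 : ℝ) < n := by exact_mod_cast (by omega : 0 < n)
  have hcard : (((Icc 1 n ×ˢ Icc 1 n).filter (fun q : ℕ × ℕ => q.2 ≤ q.1)).card : ℝ)
      ≤ (n : ℝ) ^ 2 := by
    have := card_filter_le (Icc 1 n ×ˢ Icc 1 n) (fun q : ℕ × ℕ => q.2 ≤ q.1)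
    rw [card_product, Nat.card_Icc, Nat.add_sub_cancel] at this
    rw [pow_two]
    exact_mod_cast this
  refine (measureReal_biUnion_finset_le _ _).trans ((sum_le_sum fun q hq => ?_).trans
    (b := ∑ q ∈ (Icc 1 n ×ˢ Icc 1 n).filter (fun q : ℕ × ℕ => q.2 ≤ q.1),
      Real.exp (-n) / (n : ℝ) ^ 2) ?_)
  · simp only [mem_filter, mem_product, mem_Icc] at hq
    exact hA.measure_netBad_le hP hn hq.1.2.1 hq.2 hq.1.1.2
  · rw [sum_const, nsmul_eq_mul]
    calc _ ≤ (n : ℝ) ^ 2 * (Real.exp (-n) / (n : ℝ) ^ 2) := by gcongr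
      _ = _ := by field_simp

end Probability

lemma half_le_log (hn : 2 ≤ n) : 1 / 2 ≤ Real.log n := by
  have h2 : Real.log 2 ≤ Real.log n := Real.log_le_log (by norm_num) (by exact_mod_cast hn)
  linarith [Real.log_two_gt_d9]

lemma netLevel_le_pen (hn : 2 ≤ n) (hL : 1 ≤ L) {C₁ C₂ : ℝ} (h1 : 72 ≤ C₁)
    (h2 : 8 ≤ C₂) : 8 * netLevel n K L ≤ pen C₁ C₂ n K L := by
  have hlog := half_le_log hn
  have hn' : (2 : ℝ) ≤ n := by exact_mod_cast hn
  have hL' : (1 : ℝ) ≤ L := by exact_mod_cast hL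
  have hlK : 0 ≤ Real.log K := Real.log_natCast_nonneg K
  have a1 : (n : ℝ) * Real.log n ≤ ((n : ℝ) * L + (K : ℝ) ^ 2) * Real.log n := by
    gcongr
    nlinarith [sq_nonneg (K : ℝ)]
  have a2 : (n : ℝ) ≤ 2 * (n * Real.log n) := by nlinarith
  have a3 : 2 * Real.log n ≤ n * Real.log n := by gcongr
  have b1 : 72 * (((n : ℝ) * L + (K : ℝ) ^ 2) * Real.log n)
      ≤ C₁ * (((n : ℝ) * L + (K : ℝ) ^ 2) * Real.log n) := by gcongr
  have b2 : 8 * ((n : ℝ) * Real.log K) ≤ C₂ * (n * Real.log K) := by gcongr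
  rw [netLevel, pen]
  linarith

lemma le_pen (hn : 2 ≤ n) (hL : 1 ≤ L) {C₁ C₂ : ℝ} (h1 : 72 ≤ C₁) (h2 : 8 ≤ C₂) :
    36 * (n : ℝ) ≤ pen C₁ C₂ n K L := by
  have hlog := half_le_log hn
  have hL' : (1 : ℝ) ≤ L := by exact_mod_cast hL
  have hlK : 0 ≤ Real.log K := Real.log_natCast_nonneg K
  have a1 : (n : ℝ) * (1 / 2) ≤ ((n : ℝ) * L + (K : ℝ) ^ 2) * Real.log n := by
    gcongr
    nlinarith [sq_nonneg (K : ℝ), (Nat.cast_nonneg n : (0 : ℝ) ≤ n)]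
  have b1 : 72 * (((n : ℝ) * L + (K : ℝ) ^ 2) * Real.log n)
      ≤ C₁ * (((n : ℝ) * L + (K : ℝ) ^ 2) * Real.log n) := by gcongr
  have b2 : 0 ≤ C₂ * (n * Real.log K) := by positivity
  rw [pen]
  linarith

lemma frobSq_sub_sub (A M P : Matrix (Fin n) (Fin n) ℝ) :
    frobSq (A - M) = frobSq (A - P) + frobSq (M - P) - 2 * frobInner (A - P) (M - P) := by
  simp only [frobSq, frobInner, mul_sum, ← sum_add_distrib, ← sum_sub_distrib, Matrix.sub_apply]
  exact sum_congr rfl fun i _ => sum_congr rfl fun j _ => by ring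

lemma frobInner_sub_right (M N N' : Matrix (Fin n) (Fin n) ℝ) :
    frobInner M (N - N') = frobInner M N - frobInner M N' := by
  simp only [frobInner, ← sum_sub_distrib, Matrix.sub_apply, mul_sub]

lemma frobSq_sub_comm (M N : Matrix (Fin n) (Fin n) ℝ) : frobSq (M - N) = frobSq (N - M) := by
  simp only [frobSq, Matrix.sub_apply]
  exact sum_congr rfl fun i _ => sum_congr rfl fun j _ => by ring

lemma sum_sum_le_of_le {f : Fin n → Fin n → ℝ} {b : ℝ} (h : ∀ i j, f i j ≤ b) :
    ∑ i, ∑ j, f i j ≤ (n : ℝ) ^ 2 * b := by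
  calc ∑ i, ∑ j, f i j ≤ ∑ _i : Fin n, ∑ _j : Fin n, b :=
        sum_le_sum fun i _ => sum_le_sum fun j _ => h i j
    _ = (n : ℝ) ^ 2 * b := by simp; ring

lemma frobSq_sub_le {M N : Matrix (Fin n) (Fin n) ℝ} (hM : ∀ i j, M i j ∈ Set.Icc (0 : ℝ) 1)
    (hN : ∀ i j, N i j ∈ Set.Icc (0 : ℝ) 1) : frobSq (M - N) ≤ (n : ℝ) ^ 2 := by
  rw [← mul_one ((n : ℝ) ^ 2)]
  refine sum_sum_le_of_le fun i j => ?_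
  rw [Matrix.sub_apply, sq_le_one_iff_abs_le_one, abs_le]
  constructor <;> linarith [(hM i j).1, (hM i j).2, (hN i j).1, (hN i j).2]

lemma frobInner_noise_le {A P D : Matrix (Fin n) (Fin n) ℝ} {δ : ℝ}
    (hA : ∀ i j, A i j = 0 ∨ A i j = 1) (hP : ∀ i j, P i j ∈ Set.Icc (0 : ℝ) 1)
    (hD : ∀ i j, |D i j| ≤ δ) :
    frobInner (noise A P) D ≤ (n : ℝ) ^ 2 * δ := by
  refine sum_sum_le_of_le fun i j => ?_
  have h1 : |noise A P i j| ≤ 1 := by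
    rw [noise, Matrix.of_apply]
    split_ifs
    · simp
    · rw [abs_le]
      rcases hA i j with h | h <;> constructor <;> linarith [(hP i j).1, (hP i j).2]
  calc noise A P i j * D i j ≤ |noise A P i j| * |D i j| := by rw [← abs_mul]; exact le_abs_self _
    _ ≤ 1 * δ := by gcongr; exact hD i j
    _ = δ := one_mul _

/-- Removing the diagonal from `A - P` costs at most `n` against a difference of matrices with
entries in `[0, 1]`. -/
lemma frobInner_sub_le {A P M N : Matrix (Fin n) (Fin n) ℝ} (hA : ∀ i, A i i = 0)
    (hP : ∀ i j, P i j ∈ Set.Icc (0 : ℝ) 1) (hM : ∀ i j, M i j ∈ Set.Icc (0 : ℝ) 1)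
    (hN : ∀ i j, N i j ∈ Set.Icc (0 : ℝ) 1) :
    frobInner (A - P) (M - N) ≤ frobInner (noise A P) (M - N) + n := by
  have h : ∀ i, ∑ j, (A - P) i j * (M - N) i j ≤ ∑ j, noise A P i j * (M - N) i j + 1 := fun i => by
    have : (1 : ℝ) = ∑ j, if i = j then 1 else 0 := by simp
    rw [this, ← sum_add_distrib]
    refine sum_le_sum fun j _ => ?_
    simp only [noise, Matrix.of_apply, Matrix.sub_apply]
    split_ifs with hij
    · subst hij
      rw [hA]
      nlinarith [(hP i i).1, (hP i i).2, (hM i i).1, (hM i i).2, (hN i i).1, (hN i i).2]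
    · simp
  calc frobInner (A - P) (M - N) ≤ ∑ i, (∑ j, noise A P i j * (M - N) i j + 1) :=
        sum_le_sum fun i _ => h i
    _ = _ := by simp [sum_add_distrib, frobInner]

lemma frobSq_sub_le_two_mul {M N P : Matrix (Fin n) (Fin n) ℝ} {δ : ℝ}
    (h : ∀ i j, |N i j - M i j| ≤ δ) :
    frobSq (M - P) ≤ 2 * frobSq (N - P) + 2 * ((n : ℝ) ^ 2 * δ ^ 2) := by
  have h1 : ∑ i, ∑ j, ((M i j - P i j) ^ 2 - 2 * (N i j - P i j) ^ 2) ≤ (n : ℝ) ^ 2 * (2 * δ ^ 2) :=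
    sum_sum_le_of_le fun i j => by
      have := sq_le_sq.2 ((h i j).trans (le_abs_self δ))
      nlinarith [sq_nonneg ((M i j - N i j) - (N i j - P i j))]
  simp only [sum_sub_distrib, ← mul_sum] at h1
  simp only [frobSq, Matrix.sub_apply]
  linarith

/-- On the event where the noise is controlled, minimality of the criterion forces the oracle
inequality. -/
lemma oracle_of_noise_le {C₁ C₂ : ℝ} (hC₁ : 72 ≤ C₁) (hC₂ : 8 ≤ C₂) (hn : 2 ≤ n)
    {A P : Matrix (Fin n) (Fin n) ℝ} (hA : ∀ i j, A i j = 0 ∨ A i j = 1) (hA0 : ∀ i, A i i = 0)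
    (hP : ∀ i j, P i j ∈ Set.Icc (0 : ℝ) 1) {f g : Candidate n}
    (hfg : criterion C₁ C₂ A f ≤ criterion C₁ C₂ A g)
    (hf : ∀ p : NetIndex n f.K f.L, 2 * frobInner (noise A P) (netPoint p - P) ≤
      frobSq (netPoint p - P) / 8 + 8 * netLevel n f.K f.L)
    (hg : 2 * frobInner (noise A P) (P - g.prob) ≤ frobSq (P - g.prob) / 8 + 8 * n) :
    frobSq (f.prob - P) ≤ 3 * (frobSq (g.prob - P) + pen C₁ C₂ n g.K g.L) := by
  obtain ⟨p, hp⟩ := exists_netPoint_near hn f.mem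
  have hn' : (2 : ℝ) ≤ n := by exact_mod_cast hn
  rw [criterion, criterion, frobSq_rearranged_sub, frobSq_rearranged_sub,
    frobSq_sub_sub A _ P, frobSq_sub_sub A (restored g.z g.c g.Θ) P] at hfg
  change frobSq (A - P) + frobSq (f.prob - P) - 2 * frobInner (A - P) (f.prob - P) + _ ≤
    frobSq (A - P) + frobSq (g.prob - P) - 2 * frobInner (A - P) (g.prob - P) + _ at hfg
  have hdiag := frobInner_sub_le hA0 hP f.prob_mem_Icc g.prob_mem_Icc
  have hnet : frobInner (noise A P) (f.prob - netPoint p) ≤ (n : ℝ) ^ 2 * (1 / n) :=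
    frobInner_noise_le hA hP hp
  have hsq : frobSq (netPoint p - P) ≤ 2 * frobSq (f.prob - P) + 2 * ((n : ℝ) ^ 2 * (1 / n) ^ 2) :=
    frobSq_sub_le_two_mul hp
  have e1 : (n : ℝ) ^ 2 * (1 / n) = n := by field_simp
  have e2 : (n : ℝ) ^ 2 * (1 / n) ^ 2 = 1 := by field_simp
  rw [e1] at hnet
  rw [e2] at hsq
  have hfp := hf p
  have hl := netLevel_le_pen (K := f.K) hn f.one_le_L hC₁ hC₂
  have hpen := le_pen (K := g.K) hn g.one_le_L hC₁ hC₂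
  have hg0 := frobSq_nonneg (g.prob - P)
  rw [frobSq_sub_comm P g.prob] at hg
  simp only [frobInner_sub_right] at hfg hdiag hnet hfp hg
  linarith

section Probability

variable {Ω : Type*} [MeasurableSpace Ω] {μ : Measure Ω} [IsProbabilityMeasure μ]
  {A : Ω → Matrix (Fin n) (Fin n) ℝ} {P : Matrix (Fin n) (Fin n) ℝ} {est : Ω → Candidate n}

/-- The oracle inequality fails with probability at most `2 exp (-n)`: one `exp (-n)` for the net,
one for the single direction given by the competitor. -/
lemma IsNetwork.measure_not_oracle_le (hA : IsNetwork μ P A) (hP : P.IsSymm)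
    (hP01 : ∀ i j, P i j ∈ Set.Icc (0 : ℝ) 1) (hn : 2 ≤ n) {C₁ C₂ : ℝ} (hC₁ : 72 ≤ C₁)
    (hC₂ : 8 ≤ C₂) (hest : ∀ ω, IsSolution C₁ C₂ (A ω) (est ω)) (g : Candidate n) :
    μ.real {ω | frobSq ((est ω).prob - P) ≤
      3 * (frobSq (g.prob - P) + pen C₁ C₂ n g.K g.L)}ᶜ ≤ 2 * Real.exp (-n) := by
  rw [two_mul]
  refine (measureReal_mono ?_).trans ((measureReal_union_le _ _).trans
    (add_le_add (hA.measure_biUnion_netBad_le hP hn) (hA.deviation hP (P - g.prob) n)))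
  refine Set.compl_subset_comm.2 fun ω hω => ?_
  rw [Set.mem_compl_iff, Set.mem_union, not_or] at hω
  refine oracle_of_noise_le hC₁ hC₂ hn (hA.zero_or_one ω) (hA.no_loops ω) hP01 (hest ω g)
    (fun p => ?_) ?_
  · by_contra hp
    refine hω.1 (Set.mem_biUnion (x := ((est ω).K, (est ω).L)) ?_
      (Set.mem_iUnion.2 ⟨p, (not_le.1 hp).le⟩))
    have h1 := (est ω).one_le_L
    have h2 := (est ω).L_le_K
    have h3 := (est ω).K_le_n
    simp only [coe_filter, mem_product, mem_Icc, Set.mem_ofPred_eq]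
    omega
  · by_contra hg
    exact hω.2 (not_le.1 hg).le

lemma measurable_frobSq_prob_sub (hm : ∀ i j, Measurable fun ω => (est ω).prob i j) :
    Measurable fun ω => frobSq ((est ω).prob - P) := by
  simp only [frobSq, Matrix.sub_apply]
  exact Finset.measurable_sum _ fun i _ => Finset.measurable_sum _ fun j _ =>
    ((hm i j).sub_const _).pow_const 2

lemma integrable_frobSq_prob_sub (hP01 : ∀ i j, P i j ∈ Set.Icc (0 : ℝ) 1)
    (hm : ∀ i j, Measurable fun ω => (est ω).prob i j) :
    Integrable (fun ω => frobSq ((est ω).prob - P)) μ :=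
  Integrable.of_mem_Icc 0 ((n : ℝ) ^ 2) (measurable_frobSq_prob_sub hm).aemeasurable
    (ae_of_all _ fun ω => ⟨frobSq_nonneg _, frobSq_sub_le (est ω).prob_mem_Icc hP01⟩)

end Probability

/-- A variable bounded by `b` has
expectation at most `r` plus `b` times the probability of exceeding `r`. -/
lemma integral_le_add_mul_measure_compl {Ω : Type*} [MeasurableSpace Ω] {μ : Measure Ω}
    [IsProbabilityMeasure μ] {X : Ω → ℝ} {r b : ℝ} (hX : Measurable X) (hXi : Integrable X μ)
    (hr : 0 ≤ r) (hb : ∀ ω, X ω ≤ b) :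
    ∫ ω, X ω ∂μ ≤ r + b * μ.real {ω | X ω ≤ r}ᶜ := by
  have hs : MeasurableSet {ω | X ω ≤ r}ᶜ := (measurableSet_le hX measurable_const).compl
  have hi : Integrable ({ω | X ω ≤ r}ᶜ.indicator fun _ => b) μ :=
    (integrable_const b).indicator hs
  calc ∫ ω, X ω ∂μ ≤ ∫ ω, (r + {ω | X ω ≤ r}ᶜ.indicator (fun _ => b) ω) ∂μ := by
        refine integral_mono hXi ((integrable_const r).add hi) fun ω => ?_
        by_cases h : X ω ≤ r
        · simp [Set.indicator, h]
        · have := hb ω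
          simp only [Set.indicator, Set.mem_compl_iff, Set.mem_ofPred_eq, h, not_false_eq_true,
            if_true]
          linarith
    _ = r + b * μ.real {ω | X ω ≤ r}ᶜ := by
        rw [integral_add (integrable_const r) hi, integral_indicator_const _ hs]
        simp [mul_comm]

end NBM

theorem theorem1 :
    ∃ c₁ c₂ : ℝ, 0 < c₁ ∧ 0 < c₂ ∧ ∀ C₁ C₂ : ℝ, c₁ ≤ C₁ → c₂ ≤ C₂ →
    ∀ n : ℕ, 2 ≤ n →
    -- the true model
    ∀ Ks Ls : ℕ, 1 ≤ Ls → Ls ≤ Ks → Ks ≤ n →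
    ∀ (zs : Fin n → Fin Ks) (cs : Fin Ks → Fin Ls)
      (Bs : Matrix (Fin Ks) (Fin Ks) ℝ) (Hs : Matrix (Fin n) (Fin Ls) ℝ)
      (Θs Ps : Matrix (Fin n) (Fin n) ℝ) (lam : ℝ),
    NBM.IsNBMRep zs cs Bs Hs Θs → Ps = NBM.restored zs cs Θs → Ps.IsSymm →
    0 < lam → NBM.WellConditioned Bs lam → NBM.SubvectorsIndep zs cs Hs →
    -- the observed network and the estimator
    ∀ {Ω : Type*} [MeasurableSpace Ω] (μ : Measure Ω) [IsProbabilityMeasure μ]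
      (A : Ω → Matrix (Fin n) (Fin n) ℝ) (est : Ω → NBM.Candidate n),
    NBM.IsNetwork μ Ps A →
    (∀ ω, NBM.IsSolution C₁ C₂ (A ω) (est ω)) →
    (∀ i j, Measurable fun ω => (est ω).prob i j) →
    -- the competitor
    ∀ K L : ℕ, 1 ≤ L → L ≤ K → K ≤ n →
    ∀ (z : Fin n → Fin K) (c : Fin K → Fin L) (Θ P : Matrix (Fin n) (Fin n) ℝ),
    Θ ∈ NBM.paramSet z c → P = NBM.restored z c Θ →
    1 - ((n : ℝ) ^ 2 * Real.logb 2 n + 1) * Real.exp (-(n : ℝ) / 32) ≤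
      μ.real {ω | NBM.frobSq ((est ω).prob - Ps) ≤
        3 * (NBM.frobSq (P - Ps) + NBM.pen C₁ C₂ n K L)} ∧
    Integrable (fun ω => NBM.frobSq ((est ω).prob - Ps)) μ ∧
    ∫ ω, NBM.frobSq ((est ω).prob - Ps) ∂μ ≤
      3 * (NBM.frobSq (P - Ps) + NBM.pen C₁ C₂ n K L)
        + (n : ℝ) ^ 5 * Real.exp (-(n : ℝ) / 32) := by
  -- Eight times `netLevel` is at most `72 (n L + K²) ln n + 8 n ln K`, see `netLevel_le_pen`.
  refine ⟨72, 8, by norm_num, by norm_num, fun C₁ C₂ hC₁ hC₂ n hn Ks Ls _ _ _ zs cs Bs Hs Θs Ps lam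
    hrep hPs hsymm _ _ _ Ω _ μ _ A est hA hest hm K L hL hLK hK z c Θ P hΘ hP => ?_⟩
  have hP01 : ∀ i j, Ps i j ∈ Set.Icc (0 : ℝ) 1 := fun i j => by
    rw [hPs]
    exact NBM.restored_mem_Icc ⟨Bs, Hs, hrep⟩ i j
  have hbad : μ.real {ω | NBM.frobSq ((est ω).prob - Ps) ≤
      3 * (NBM.frobSq (P - Ps) + NBM.pen C₁ C₂ n K L)}ᶜ ≤ 2 * Real.exp (-n) := by
    subst hP
    exact hA.measure_not_oracle_le hsymm hP01 hn hC₁ hC₂ hest ⟨K, L, hL, hLK, hK, z, c, Θ, hΘ⟩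
  have hn' : (2 : ℝ) ≤ n := by exact_mod_cast hn
  have hexp : Real.exp (-(n : ℝ)) ≤ Real.exp (-(n : ℝ) / 32) := Real.exp_le_exp.2 (by linarith)
  have hpen := NBM.le_pen (K := K) hn hL hC₁ hC₂
  have hfr := NBM.frobSq_nonneg (P - Ps)
  have hmeas := NBM.measurable_frobSq_prob_sub (P := Ps) hm
  have hint := NBM.integrable_frobSq_prob_sub (μ := μ) hP01 hm
  refine ⟨?_, hint, ?_⟩
  · have hlog : 1 ≤ Real.logb 2 n := by
      rw [Real.le_logb_iff_rpow_le (by norm_num) (by linarith), Real.rpow_one]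
      exact hn'
    have h4 : 1 ≤ (n : ℝ) ^ 2 * Real.logb 2 n := by nlinarith
    rw [probReal_compl_eq_one_sub (measurableSet_le hmeas measurable_const)] at hbad
    have h5 := mul_le_mul_of_nonneg_right (by linarith : 2 ≤ (n : ℝ) ^ 2 * Real.logb 2 n + 1)
      (Real.exp_pos (-(n : ℝ) / 32)).le
    linarith
  · refine (NBM.integral_le_add_mul_measure_compl hmeas hint
      (r := 3 * (NBM.frobSq (P - Ps) + NBM.pen C₁ C₂ n K L)) (by linarith)
      fun ω => NBM.frobSq_sub_le (est ω).prob_mem_Icc hP01).trans ?_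
    refine add_le_add le_rfl ?_
    calc (n : ℝ) ^ 2 * _ ≤ (n : ℝ) ^ 2 * (2 * Real.exp (-(n : ℝ))) := by gcongr
      _ ≤ (n : ℝ) ^ 2 * (2 ^ 3 * Real.exp (-(n : ℝ) / 32)) := by gcongr; norm_num
      _ ≤ (n : ℝ) ^ 2 * ((n : ℝ) ^ 3 * Real.exp (-(n : ℝ) / 32)) := by gcongr
      _ = _ := by ring
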